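/- Let $G$ be a non-empty finite simple graph and let $\mathcal{H}=\{H_x \mid x\in V(G)\}$ be a family of non-empty finite simple graphs indexed by the vertices of $G$, where $G$ and the graphs $H_x$ have pairwise disjoint vertex sets. The corona $G\circ\mathcal{H}$ is the graph obtained from the disjoint union of $G$ and all the $H_x$ by adding, for each vertex $x$ of $G$, all edges joining $x$ to the vertices of $H_x$. For a finite simple graph $\Gamma$, let $\Delta_\Gamma$ be its independence complex, whose faces are the independent sets of vertices of $\Gamma$. For a field $k$, the Stanley–Reisner ring $k[\Delta_\Gamma]$ is the quotient of the polynomial ring $k[X_v \mid v\in V(\Gamma)]$ by the ideal generated by all monomials $\prod_{v\in F}X_v$ with $F\subseteq V(\Gamma)$ not a face of $\Delta_\Gamma$. The graph $\Gamma$ is called Cohen–Macaulay over $k$ if $k[\Delta_\Gamma]$ is a Cohen–Macaulay ring, i.e. it is Noetherian and its localization at every maximal ideal has depth equal to its Krull dimension. Then, for every field $k$, $G\circ\mathcal{H}$ is Cohen–Macaulay over $k$ if and only if $H_x$ is a complete graph for every $x\in V(G)$. -/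

import Mathlib

namespace CoronaCM

/-! ### Cohen–Macaulay rings -/

/-- The depth of a local ring `R`: the supremum of the lengths of the `R`-regular sequences that
consist of elements of the maximal ideal. -/
noncomputable def localDepth (R : Type*) [CommRing R] [IsLocalRing R] : ℕ∞ :=
  ⨆ rs : {rs : List R // (∀ r ∈ rs, r ∈ IsLocalRing.maximalIdeal R) ∧
    RingTheory.Sequence.IsRegular R rs}, (rs.1.length : ℕ∞)

/-- A local ring is Cohen–Macaulay if it is Noetherian and its depth equals its Krull dimension. -/
structure IsCohenMacaulayLocalRing (R : Type*) [CommRing R] [IsLocalRing R] : Prop where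
  isNoetherianRing : IsNoetherianRing R
  depth_eq_dim : (localDepth R : WithBot ℕ∞) = ringKrullDim R

/-- A commutative ring is Cohen–Macaulay if it is Noetherian and its localization at every maximal
ideal is a Cohen–Macaulay local ring. -/
structure IsCohenMacaulayRing (R : Type*) [CommRing R] : Prop where
  isNoetherianRing : IsNoetherianRing R
  localization : ∀ (m : Ideal R) [m.IsMaximal],
    IsCohenMacaulayLocalRing (Localization.AtPrime m)

/-! ### Stanley–Reisner rings -/

/-- The Stanley–Reisner ideal of a simplicial complex `Δ` over `k`: it is generated by the
squarefree monomials `∏ v ∈ F, X v` of the non-faces `F` of `Δ`. Mathlib does not list the empty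
face among the faces of a complex; it is always a face, so non-faces are nonempty. -/
noncomputable def stanleyReisnerIdeal (k : Type*) [Field k] {V : Type*}
    (Δ : AbstractSimplicialComplex V) : Ideal (MvPolynomial V k) :=
  Ideal.span {p | ∃ F : Finset V, F.Nonempty ∧ F ∉ Δ ∧ p = ∏ v ∈ F, MvPolynomial.X v}

/-- The Stanley–Reisner ring `k[Δ]`. -/
abbrev StanleyReisnerRing (k : Type*) [Field k] {V : Type*}
    (Δ : AbstractSimplicialComplex V) : Type _ :=
  MvPolynomial V k ⧸ stanleyReisnerIdeal k Δ

/-! ### Graphs -/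

/-- The independence complex of a graph: its (nonempty) faces are the (nonempty) finite independent
sets of vertices. -/
def independenceComplex {V : Type*} (G : SimpleGraph V) : AbstractSimplicialComplex V where
  faces := {F | F.Nonempty ∧ G.IsIndepSet (F : Set V)}
  isRelLowerSet_faces := fun {_} hs =>
    ⟨hs.1, fun _ hts ht => ⟨ht, hs.2.mono (Finset.coe_subset.mpr hts)⟩⟩
  singleton_mem v := ⟨Finset.singleton_nonempty v, by simp [SimpleGraph.IsIndepSet]⟩

/-- A graph is Cohen–Macaulay over `k` if the Stanley–Reisner ring over `k` of its independence
complex is Cohen–Macaulay. -/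
def IsCohenMacaulayGraph (k : Type*) [Field k] {V : Type*} (G : SimpleGraph V) : Prop :=
  IsCohenMacaulayRing (StanleyReisnerRing k (independenceComplex G))

/-- Adjacency in the corona of `G` and the family `H`: the edges of `G`, the edges of each `H x`,
and the edges joining each vertex `x` of `G` to every vertex of `H x`. -/
inductive CoronaAdj {V : Type*} {W : V → Type*} (G : SimpleGraph V)
    (H : ∀ x, SimpleGraph (W x)) : V ⊕ (Σ x, W x) → V ⊕ (Σ x, W x) → Prop
  | base {x y : V} (h : G.Adj x y) : CoronaAdj G H (Sum.inl x) (Sum.inl y)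
  | fiber {x : V} {a b : W x} (h : (H x).Adj a b) :
      CoronaAdj G H (Sum.inr ⟨x, a⟩) (Sum.inr ⟨x, b⟩)
  | join (x : V) (a : W x) : CoronaAdj G H (Sum.inl x) (Sum.inr ⟨x, a⟩)
  | join' (x : V) (a : W x) : CoronaAdj G H (Sum.inr ⟨x, a⟩) (Sum.inl x)

/-- The corona of a graph `G` and a family of graphs `H x` indexed by the vertices `x` of `G`. -/
def corona {V : Type*} {W : V → Type*} (G : SimpleGraph V) (H : ∀ x, SimpleGraph (W x)) :
    SimpleGraph (V ⊕ (Σ x, W x)) where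
  Adj := CoronaAdj G H
  symm.symm _ _ h := by
    cases h with
    | base h => exact .base h.symm
    | fiber h => exact .fiber h.symm
    | join x a => exact .join' x a
    | join' x a => exact .join x a
  loopless.irrefl v h := by
    cases h with
    | base h => exact G.loopless.irrefl _ h
    | fiber h => exact (H _).loopless.irrefl _ h

end CoronaCM

/-! ### Depth, dimension, and algebras finite free over a polynomial ring -/

namespace CoronaCM
open RingTheory.Sequence IsLocalRing
open scoped Pointwise

/-! If every `H x` is complete, the sets `{x} ∪ W x` partition the corona into cliques, and a vertex
of `W x` has no neighbour outside its clique. Let `θ x` be the sum of the variables in the clique of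
`x`. The face ring is then free over the polynomial ring in the `θ x`, with basis the squarefree
monomials of the independent sets that avoid one chosen such vertex per clique. A ring finite and
free over a polynomial ring over a field is Cohen–Macaulay (`isCohenMacaulayRing_of_free`).

Conversely, Cohen–Macaulayness forces all facets to have the same size (`card_le_card`). Localize at
the origin. The monomial of a facet `F` is killed by every variable outside `F`, so the depth is at
most `|F|`, because depth is bounded by the dimension at any associated prime. Projection onto a
face `E` shows that the dimension is at least `|E|`. If `a`, `c` are distinct and nonadjacent in `H
x`, take maximal independent sets in the other `H y`: adding `x` to their union gives a facet, while
adding `a` and `c` gives a larger independent set. -/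

theorem ringKrullDim_quotient_succ_le_of_lt {R : Type*} [CommRing R] {p q : Ideal R} [p.IsPrime]
    (hpq : p ≤ q) {r : R} (hrp : r ∉ p) (hrq : r ∈ q) :
    ringKrullDim (R ⧸ q) + 1 ≤ ringKrullDim (R ⧸ p) := by
  refine ringKrullDim_succ_le_of_surjective (Ideal.Quotient.factor hpq)
    (Ideal.Quotient.factor_surjective hpq) (r := Ideal.Quotient.mk p r) ?_ ?_
  · rw [mem_nonZeroDivisors_iff_ne_zero, Ne, Ideal.Quotient.eq_zero_iff_mem]
    exact hrp
  · rw [Ideal.Quotient.factor_mk, Ideal.Quotient.eq_zero_iff_mem]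
    exact hrq

/-- A weakly regular sequence in the maximal ideal is at most as long as the dimension of any
associated prime of the module. -/
theorem length_le_ringKrullDim_quotient_of_isAssociatedPrime {R : Type*} [CommRing R]
    [IsLocalRing R] [IsNoetherianRing R] {M : Type*} [AddCommGroup M] [Module R M]
    [Module.Finite R M] {rs : List R} (hmem : ∀ r ∈ rs, r ∈ maximalIdeal R)
    (hrs : IsWeaklyRegular M rs) {p : Ideal R} (hp : IsAssociatedPrime p M) :
    (rs.length : WithBot ℕ∞) ≤ ringKrullDim (R ⧸ p) := by
  induction rs generalizing M p with
  | nil =>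
    have := hp.isPrime
    exact ringKrullDim_nonneg_of_nontrivial
  | cons r rs ih =>
    have hprime := hp.isPrime
    rw [isWeaklyRegular_cons_iff] at hrs
    obtain ⟨hr, hrs⟩ := hrs
    have hrm : r ∈ maximalIdeal R := hmem r (by simp)
    obtain ⟨x, hx⟩ := (isAssociatedPrime_iff.mp hp).2
    have hmemp : ∀ a : R, a ∈ p ↔ a • x = 0 := fun a => by
      rw [hx, Submodule.mem_colon_singleton, Submodule.mem_bot]
    have hx0 : x ≠ 0 := fun h => hprime.ne_top ((Ideal.eq_top_iff_one p).2 ((hmemp 1).2 (by simp [h])))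
    have hrp : r ∉ p := fun h => hx0 (hr (by simpa using (hmemp r).1 h))
    let N : Submodule R M := Submodule.torsionBySet R M p
    have hN : ∀ z : M, z ∈ N ↔ ∀ a ∈ p, a • z = 0 := fun z => by
      simp [N, Submodule.mem_torsionBySet_iff]
    have hxN : x ∈ N := (hN x).2 fun a ha => (hmemp a).1 ha
    -- If `N ⊆ rM`, regularity of `r` gives `N = rN`, so `N = 0` by Nakayama. Hence some `z` killed
    -- by `p` survives in `M/rM`, and an associated prime over its annihilator contains both `p` and
    -- `r`.
    have key : ∃ z ∈ N, z ∉ (r • ⊤ : Submodule R M) := by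
      by_contra! hcon
      have hle : N ≤ Ideal.span {r} • N := by
        intro z hz
        obtain ⟨y, -, rfl⟩ := (Submodule.mem_smul_pointwise_iff_exists _ _ _).1 (hcon z hz)
        refine Submodule.smul_mem_smul (Ideal.mem_span_singleton_self r) ((hN y).2 fun a ha => ?_)
        apply hr
        have := (hN _).1 hz a ha
        simp only [smul_zero]
        rwa [smul_comm]
      have := Submodule.eq_bot_of_le_smul_of_le_jacobson_bot (Ideal.span {r}) N
        (IsNoetherian.noetherian N) hle
        (((Ideal.span_singleton_le_iff_mem _).2 hrm).trans (maximalIdeal_le_jacobson _))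
      exact hx0 (by simpa [this] using hxN)
    obtain ⟨z, hzN, hz⟩ := key
    have hz0 : (Submodule.Quotient.mk z : QuotSMulTop r M) ≠ 0 := by
      rwa [Ne, Submodule.Quotient.mk_eq_zero]
    obtain ⟨q, hq, hle⟩ := exists_le_isAssociatedPrime_of_isNoetherianRing R _ hz0
    have hpq : p ≤ q := fun a ha => hle <| by
      rw [Submodule.mem_colon_singleton, ← Submodule.Quotient.mk_smul, (hN z).1 hzN a ha]
      simp
    have hrq : r ∈ q := hle <| by
      rw [Submodule.mem_colon_singleton, ← Submodule.Quotient.mk_smul, Submodule.mem_bot,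
        Submodule.Quotient.mk_eq_zero]
      exact Submodule.smul_mem_pointwise_smul _ _ _ trivial
    have h1 := ih (fun a ha => hmem a (by simp [ha])) hrs hq
    refine le_trans ?_ (ringKrullDim_quotient_succ_le_of_lt hpq hrp hrq)
    rw [List.length_cons, Nat.cast_add, Nat.cast_one]
    gcongr

/-- The depth of a Noetherian local ring is at most the dimension of any quotient by an ideal that
annihilates a nonzero element. -/
theorem localDepth_le_of_annihilates {R : Type*} [CommRing R] [IsLocalRing R] [IsNoetherianRing R]
    {I : Ideal R} {z : R} (hz : z ≠ 0) (hI : ∀ a ∈ I, a * z = 0) :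
    (localDepth R : WithBot ℕ∞) ≤ ringKrullDim (R ⧸ I) := by
  obtain ⟨q, hq, hle⟩ := exists_le_isAssociatedPrime_of_isNoetherianRing R z hz
  have hIq : I ≤ q := fun a ha => hle <| by
    rw [Submodule.mem_colon_singleton, smul_eq_mul, hI a ha]; simp
  have hqI : ringKrullDim (R ⧸ q) ≤ ringKrullDim (R ⧸ I) :=
    ringKrullDim_le_of_surjective _ (Ideal.Quotient.factor_surjective hIq)
  refine le_trans ?_ hqI
  have := hq.isPrime
  obtain ⟨d, hd⟩ := WithBot.ne_bot_iff_exists.1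
    (ne_bot_of_le_ne_bot WithBot.zero_ne_bot
      (ringKrullDim_nonneg_of_nontrivial (R := R ⧸ q)))
  rw [← hd, WithBot.coe_le_coe]
  refine iSup_le fun rs => ?_
  rw [← WithBot.coe_le_coe, hd]
  exact length_le_ringKrullDim_quotient_of_isAssociatedPrime rs.2.1 rs.2.2.toIsWeaklyRegular hq

theorem localDepth_le_ringKrullDim (R : Type*) [CommRing R] [IsLocalRing R] [IsNoetherianRing R] :
    (localDepth R : WithBot ℕ∞) ≤ ringKrullDim R := by
  refine (localDepth_le_of_annihilates (I := (⊥ : Ideal R)) one_ne_zero (by simp)).trans ?_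
  exact ringKrullDim_quotient_le _

/-- Incomparability: contraction of primes along an integral extension is strictly monotone. -/
theorem ringKrullDim_le_of_isIntegral (A R : Type*) [CommRing A] [CommRing R] [Algebra A R]
    [Algebra.IsIntegral A R] : ringKrullDim R ≤ ringKrullDim A := by
  refine Order.krullDim_le_of_strictMono (PrimeSpectrum.comap (algebraMap A R)) fun I J hIJ => ?_
  obtain ⟨hle, x, hxJ, hxI⟩ := SetLike.lt_iff_le_and_exists.1
    ((PrimeSpectrum.asIdeal_lt_asIdeal _ _).2 hIJ)
  rw [← PrimeSpectrum.asIdeal_lt_asIdeal]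
  exact Ideal.comap_lt_comap_of_integral_mem_sdiff hle ⟨hxJ, hxI⟩ (Algebra.IsIntegral.isIntegral x)

theorem ringKrullDim_localization_atPrime_le {R : Type*} [CommRing R] (m : Ideal R) [m.IsPrime] :
    ringKrullDim (Localization.AtPrime m) ≤ ringKrullDim R := by
  rw [IsLocalization.AtPrime.ringKrullDim_eq_height m]
  exact Ideal.height_le_ringKrullDim_of_ne_top (Ideal.IsPrime.ne_top ‹_›)

open Polynomial in
-- Constants stay regular because `B[X]` is flat over `B`; modulo them `f` is still monic, hence a
-- nonzerodivisor.
theorem isWeaklyRegular_map_C_append {B : Type*} [CommRing B] {rs : List B}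
    (hrs : IsWeaklyRegular B rs) {f : B[X]} (hf : f.Monic) :
    IsWeaklyRegular B[X] (rs.map (C : B →+* B[X]) ++ [f]) := by
  rw [isWeaklyRegular_append_iff]
  refine ⟨hrs.of_flat (S := B[X]), ?_⟩
  rw [isWeaklyRegular_singleton_iff, isSMulRegular_quotient_iff_mem_of_smul_mem]
  intro g hg
  have hmap : Ideal.ofList (rs.map (C : B →+* B[X])) • (⊤ : Ideal B[X]) =
      RingHom.ker (mapRingHom (Ideal.Quotient.mk (Ideal.ofList rs))) := by
    rw [smul_eq_mul, Ideal.mul_top, ← Ideal.map_ofList, ker_mapRingHom, Ideal.mk_ker]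
  rw [hmap, RingHom.mem_ker] at hg ⊢
  rw [smul_eq_mul, map_mul] at hg
  exact (hf.map _).mul_right_eq_zero_iff.1 hg

theorem exists_isWeaklyRegular_aeval_X (k : Type*) [Field k] (σ : Type*) [Finite σ]
    (p : σ → Polynomial k) (hp : ∀ v, (p v).Monic) :
    ∃ rs : List (MvPolynomial σ k), IsWeaklyRegular (MvPolynomial σ k) rs ∧
      rs.length = Nat.card σ ∧
      ∀ r ∈ rs, ∃ v, r = Polynomial.aeval (MvPolynomial.X v : MvPolynomial σ k) (p v) := by
  induction σ using Finite.induction_empty_option with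
  | @of_equiv α β e H =>
    obtain ⟨rs, h1, h2, h3⟩ := H (p ∘ e) fun v => hp _
    let E := MvPolynomial.renameEquiv k e
    refine ⟨rs.map E, ?_, by simp [h2, Nat.card_congr e], ?_⟩
    · exact (E.toRingEquiv.toAddEquiv.isWeaklyRegular_congr (as := rs) (bs := rs.map E)
        (by simp [List.forall₂_map_right_iff])).1 h1
    · simp only [List.mem_map, forall_exists_index, and_imp, forall_apply_eq_imp_iff₂]
      intro r hr
      obtain ⟨v, rfl⟩ := h3 r hr
      refine ⟨e v, ?_⟩
      rw [← Polynomial.aeval_algHom_apply]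
      simp [E]
  | h_empty => exact ⟨[], .nil _ _, by simp, by simp⟩
  | @h_option α _ H =>
    obtain ⟨rs, h1, h2, h3⟩ := H (p ∘ some) fun v => hp _
    let E := (MvPolynomial.optionEquivLeft k α).symm
    let ss := rs.map (Polynomial.C : MvPolynomial α k →+* Polynomial (MvPolynomial α k)) ++
      [(p none).map (algebraMap k (MvPolynomial α k))]
    have hss := isWeaklyRegular_map_C_append h1 ((hp none).map (algebraMap k (MvPolynomial α k)))
    refine ⟨ss.map E, ?_, by simp [ss, h2], ?_⟩
    · exact (E.toRingEquiv.toAddEquiv.isWeaklyRegular_congr (as := ss) (bs := ss.map E)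
        (by simp [List.forall₂_map_right_iff])).1 hss
    · intro r hr
      obtain ⟨s, hs, rfl⟩ := List.mem_map.1 hr
      rcases List.mem_append.1 hs with hs | hs
      · obtain ⟨t, ht, rfl⟩ := List.mem_map.1 hs
        obtain ⟨v, rfl⟩ := h3 t ht
        refine ⟨some v, ?_⟩
        rw [AlgEquiv.symm_apply_eq]
        refine Eq.trans ?_ (Polynomial.aeval_algHom_apply
          (MvPolynomial.optionEquivLeft k α).toAlgHom (MvPolynomial.X (some v)) (p (some v)))
        rw [← Polynomial.algebraMap_eq, ← Polynomial.aeval_algebraMap_apply]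
        simp
      · rw [List.mem_singleton.1 hs]
        refine ⟨none, ?_⟩
        rw [AlgEquiv.symm_apply_eq]
        change _ = (MvPolynomial.optionEquivLeft k α).toAlgHom _
        rw [← Polynomial.aeval_algHom_apply]
        simp [Polynomial.aeval_X_left_eq_map]

/-- By the Nullstellensatz the residue field of the contraction `n` of `m` is finite over `k`. The
minimal polynomials of the coordinates, evaluated at the variables, therefore lie in `n`; they form
a regular sequence, which flatness carries to `R` and its localization. No assumption that `k` is
algebraically closed is needed. -/
theorem exists_isRegular_localization (k : Type*) [Field k] (σ : Type*) [Finite σ] {R : Type*} [CommRing R]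
    [Algebra (MvPolynomial σ k) R] [Module.Finite (MvPolynomial σ k) R]
    [Module.Free (MvPolynomial σ k) R]
    (m : Ideal R) [m.IsMaximal] :
    ∃ rs : List (Localization.AtPrime m), rs.length = Nat.card σ ∧
      (∀ r ∈ rs, r ∈ maximalIdeal (Localization.AtPrime m)) ∧
      IsRegular (Localization.AtPrime m) rs := by
  let A := MvPolynomial σ k
  let n : Ideal A := m.comap (algebraMap A R)
  have hn : n.IsMaximal := Ideal.isMaximal_comap_of_isIntegral_of_isMaximal m
  let _ : Field (A ⧸ n) := Ideal.Quotient.field n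
  have : Module.Finite k (A ⧸ n) := finite_of_finite_type_of_isJacobsonRing k (A ⧸ n)
  let x : σ → A ⧸ n := fun v => Ideal.Quotient.mk n (MvPolynomial.X v)
  obtain ⟨rs, h1, h2, h3⟩ := exists_isWeaklyRegular_aeval_X k σ (fun v => minpoly k (x v))
    fun v => minpoly.monic (Algebra.IsIntegral.isIntegral _)
  have hmem : ∀ r ∈ rs.map (algebraMap A R), r ∈ m := by
    simp only [List.mem_map, forall_exists_index, and_imp, forall_apply_eq_imp_iff₂]
    intro r hr
    obtain ⟨v, rfl⟩ := h3 r hr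
    change _ ∈ n
    rw [← Ideal.Quotient.eq_zero_iff_mem, ← Ideal.Quotient.mkₐ_eq_mk k,
      ← Polynomial.aeval_algHom_apply]
    exact minpoly.aeval k (x v)
  have hR := h1.of_flat (S := R)
  refine ⟨_, ?_, ?_, hR.isRegular_of_isLocalization_of_mem (Localization.AtPrime m) m hmem⟩
  · simp [h2]
  · intro r hr
    obtain ⟨s, hs, rfl⟩ := List.mem_map.1 hr
    exact (IsLocalization.AtPrime.to_map_mem_maximal_iff (Localization.AtPrime m) m s).2 (hmem s hs)

theorem ringKrullDim_localization_of_free (k : Type*) [Field k] (σ : Type*) [Finite σ] {R : Type*} [CommRing R]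
    [Algebra (MvPolynomial σ k) R] [Module.Finite (MvPolynomial σ k) R]
    [Module.Free (MvPolynomial σ k) R]
    (m : Ideal R) [m.IsMaximal] :
    ringKrullDim (Localization.AtPrime m) = Nat.card σ := by
  have : IsNoetherianRing R := IsNoetherianRing.of_finite (MvPolynomial σ k) R
  apply le_antisymm
  · refine (ringKrullDim_localization_atPrime_le m).trans ?_
    refine (ringKrullDim_le_of_isIntegral (MvPolynomial σ k) R).trans ?_
    simp
  · obtain ⟨rs, h1, h2, h3⟩ := exists_isRegular_localization k σ m
    rw [← ringKrullDim_add_length_eq_ringKrullDim_of_isRegular rs h3, h1]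
    have : Nontrivial (Localization.AtPrime m ⧸ Ideal.ofList rs) := by
      rw [Ideal.Quotient.nontrivial_iff]
      intro h
      exact h3.top_ne_smul (by rw [h]; simp)
    exact le_add_of_nonneg_left ringKrullDim_nonneg_of_nontrivial

/-- A ring that is finite and free over a polynomial ring over a field is Cohen–Macaulay. -/
theorem isCohenMacaulayRing_of_free (k : Type*) [Field k] (σ : Type*) [Finite σ] {R : Type*} [CommRing R]
    [Algebra (MvPolynomial σ k) R] [Module.Finite (MvPolynomial σ k) R]
    [Module.Free (MvPolynomial σ k) R] :
    IsCohenMacaulayRing R := by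
  have : IsNoetherianRing R := IsNoetherianRing.of_finite (MvPolynomial σ k) R
  refine ⟨this, fun m _ => ⟨inferInstance, le_antisymm (localDepth_le_ringKrullDim _) ?_⟩⟩
  obtain ⟨rs, h1, h2, h3⟩ := exists_isRegular_localization k σ m
  rw [ringKrullDim_localization_of_free k σ m, ← h1]
  exact WithBot.coe_le_coe.2 (le_iSup (fun rs : {rs : List (Localization.AtPrime m) //
    (∀ r ∈ rs, r ∈ maximalIdeal (Localization.AtPrime m)) ∧ IsRegular _ rs} =>
      (rs.1.length : ℕ∞)) ⟨rs, h2, h3⟩)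

end CoronaCM

/-! ### Face rings of independence complexes -/

namespace CoronaCM
open MvPolynomial IsLocalRing

/-- If the maximal ideal of a Noetherian local ring is generated by a family of elements, then the
number of those generators that do not kill a given nonzero element bounds the depth. -/
theorem localDepth_le_card {L : Type*} [CommRing L] [IsLocalRing L] [IsNoetherianRing L] {U : Type*}
    {y : U → L} (hy : maximalIdeal L = Ideal.span (Set.range y)) {z : L} (hz : z ≠ 0)
    {F : Finset U} (hF : ∀ u ∉ F, y u * z = 0) : (localDepth L : WithBot ℕ∞) ≤ F.card := by
  classical
  let I : Ideal L := Ideal.span (y '' {u | u ∉ F})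
  have hI : ∀ a ∈ I, a * z = 0 := by
    have : I ≤ (Ideal.span {z}).annihilator := by
      rw [Ideal.span_le]
      rintro _ ⟨u, hu, rfl⟩
      exact (Submodule.mem_annihilator_span_singleton _ _).2 (hF u hu)
    exact fun a ha => (Submodule.mem_annihilator_span_singleton _ _).1 (this ha)
  have hIm : I ≤ maximalIdeal L := hy ▸ Ideal.span_mono (Set.image_subset_range _ _)
  have : Nontrivial (L ⧸ I) := Ideal.Quotient.nontrivial_iff.2
    (ne_top_of_le_ne_top Ideal.IsPrime.ne_top' hIm)
  have : IsLocalRing (L ⧸ I) := .of_surjective' (Ideal.Quotient.mk I) Ideal.Quotient.mk_surjective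
  have : IsLocalHom (Ideal.Quotient.mk I) :=
    Ideal.Quotient.mk_surjective.isLocalHom (Ideal.Quotient.mk I)
  refine (localDepth_le_of_annihilates hz hI).trans
    ((ringKrullDim_le_spanFinrank_maximalIdeal _).trans ?_)
  -- The generators outside `F` vanish in `L ⧸ I`, so `|F|` generators remain and bound its
  -- dimension.
  have hmq : maximalIdeal (L ⧸ I) =
      Ideal.span (F.image (Ideal.Quotient.mk I ∘ y) : Set (L ⧸ I)) := by
    rw [← map_maximalIdeal_of_surjective (Ideal.Quotient.mk I) Ideal.Quotient.mk_surjective, hy,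
      Ideal.map_span, ← Set.range_comp]
    apply le_antisymm
    · rw [Ideal.span_le]
      rintro _ ⟨u, rfl⟩
      by_cases hu : u ∈ F
      · exact Ideal.subset_span (by simpa using ⟨u, hu, rfl⟩)
      · have : Ideal.Quotient.mk I (y u) = 0 :=
          Ideal.Quotient.eq_zero_iff_mem.2 (Ideal.subset_span ⟨u, hu, rfl⟩)
        simp [this]
    · apply Ideal.span_mono
      intro _ hx
      obtain ⟨u, -, rfl⟩ := Finset.mem_image.1 hx
      exact ⟨u, rfl⟩
  have : (maximalIdeal (L ⧸ I)).spanFinrank ≤ F.card := by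
    rw [hmq]
    refine (Submodule.spanFinrank_span_le_ncard_of_finite (Finset.finite_toSet _)).trans ?_
    rw [Set.ncard_coe_finset]
    exact Finset.card_image_le
  exact_mod_cast this

/-- `R` is generated over `k` by elements indexed by the vertices of `Γ` that satisfy the relations of
the Stanley–Reisner ring of the independence complex, and that can be evaluated on every face. -/
structure IsFaceRing (k : Type*) [Field k] {U : Type*} (Γ : SimpleGraph U) {R : Type*} [CommRing R]
    [Algebra k R] (ξ : U → R) : Prop where
  adjoin_eq_top : Algebra.adjoin k (Set.range ξ) = ⊤
  prod_eq_zero : ∀ F : Finset U, ¬ Γ.IsIndepSet (F : Set U) → ∏ u ∈ F, ξ u = 0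
  exists_eval : ∀ F : Set U, Γ.IsIndepSet F → ∃ φ : R →ₐ[k] MvPolynomial U k,
    (∀ u ∈ F, φ (ξ u) = X u) ∧ ∀ u ∉ F, φ (ξ u) = 0

theorem isFaceRing_stanleyReisnerRing (k : Type*) [Field k] {U : Type*} (Γ : SimpleGraph U) :
    IsFaceRing k Γ
      (fun u => (Ideal.Quotient.mk _ (X u) : StanleyReisnerRing k (independenceComplex Γ))) where
  adjoin_eq_top := by
    have h := congrArg (Subalgebra.map
      (Ideal.Quotient.mkₐ k (stanleyReisnerIdeal k (independenceComplex Γ))))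
      (adjoin_range_X (σ := U) (R := k))
    rw [AlgHom.map_adjoin, Algebra.map_top,
      (AlgHom.range_eq_top _).2 (Ideal.Quotient.mkₐ_surjective k _), ← Set.range_comp] at h
    exact h
  prod_eq_zero F hF := by
    have : F.Nonempty := by
      rw [Finset.nonempty_iff_ne_empty]
      rintro rfl
      exact hF (by simp [SimpleGraph.IsIndepSet])
    rw [← map_prod, Ideal.Quotient.eq_zero_iff_mem]
    exact Ideal.subset_span ⟨F, this, fun h => hF h.2, rfl⟩
  exists_eval F hF := by
    classical
    let y : U → MvPolynomial U k := fun u => if u ∈ F then X u else 0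
    have hle : stanleyReisnerIdeal k (independenceComplex Γ) ≤
        RingHom.ker (aeval y : _ →ₐ[k] MvPolynomial U k) := by
      refine Ideal.span_le.2 ?_
      rintro _ ⟨E, hE, hEΔ, rfl⟩
      obtain ⟨u, huE, huF⟩ : ∃ u ∈ E, u ∉ F := by
        by_contra! h
        exact hEΔ ⟨hE, Set.Pairwise.mono h hF⟩
      rw [SetLike.mem_coe, RingHom.mem_ker, map_prod]
      exact Finset.prod_eq_zero huE (by rw [aeval_X]; exact if_neg huF)
    refine ⟨Ideal.Quotient.liftₐ _ (aeval y) fun a ha => hle ha, fun u hu => ?_, fun u hu => ?_⟩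
    · exact (aeval_X y u).trans (if_pos hu)
    · exact (aeval_X y u).trans (if_neg hu)

namespace IsFaceRing

variable {k : Type*} [Field k] {U : Type*} {Γ : SimpleGraph U} {R : Type*} [CommRing R]
  [Algebra k R] {ξ : U → R}

theorem mul_eq_zero_of_adj (h : IsFaceRing k Γ ξ) {u w : U} (huw : Γ.Adj u w) :
    ξ u * ξ w = 0 := by
  classical
  rw [← Finset.prod_pair (f := ξ) huw.ne]
  refine h.prod_eq_zero _ fun hF => ?_
  exact hF (by simp) (by simp) huw.ne huw

theorem induction (h : IsFaceRing k Γ ξ) {P : R → Prop} (hC : ∀ c : k, P (algebraMap k R c))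
    (hadd : ∀ r s, P r → P s → P (r + s)) (hmul : ∀ r u, P r → P (r * ξ u)) (r : R) : P r := by
  have hs : Function.Surjective (aeval ξ : MvPolynomial U k →ₐ[k] R) := by
    rw [← AlgHom.range_eq_top, ← Algebra.adjoin_range_eq_range_aeval, h.adjoin_eq_top]
  obtain ⟨f, rfl⟩ := hs r
  induction f using MvPolynomial.induction_on with
  | C c => rw [aeval_C]; exact hC c
  | add p q hp hq => rw [map_add]; exact hadd _ _ hp hq
  | mul_X p u hp => rw [map_mul, aeval_X]; exact hmul _ _ hp

theorem algHom_ext (h : IsFaceRing k Γ ξ) {B : Type*} [CommRing B] [Algebra k B] {f g : R →ₐ[k] B}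
    (hfg : ∀ u, f (ξ u) = g (ξ u)) : f = g := by
  refine AlgHom.ext_of_adjoin_eq_top h.adjoin_eq_top ?_
  rintro _ ⟨u, rfl⟩
  exact hfg u

/-- If the vertices of a finite graph are partitioned into cliques, each of which contains a vertex
without neighbours outside its clique, then the face ring is finite and free over the subring
generated by the sums of the variables over the cliques; in particular it is Cohen–Macaulay. -/
theorem isCohenMacaulayRing_of_clique_partition {V : Type*} [Finite U] [Finite V]
    (h : IsFaceRing k Γ ξ) (π : U → V) (b : V → U) (hb : ∀ x, π (b x) = x)
    (hclique : ∀ u w, π u = π w → u ≠ w → Γ.Adj u w) (hfree : ∀ x w, Γ.Adj (b x) w → π w = x) :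
    IsCohenMacaulayRing R := by
  classical
  have := Fintype.ofFinite U
  have := Fintype.ofFinite V
  let A := MvPolynomial V k
  let θ : V → R := fun x => ∑ u with π u = x, ξ u
  let _ : Algebra A R := (aeval θ : A →ₐ[k] R).toRingHom.toAlgebra
  have hsmul : ∀ (a : A) (r : R), a • r = aeval θ a * r := fun a r => Algebra.smul_def a r
  -- Distinct variables of a clique multiply to zero. This trades a repeated variable for a
  -- coefficient from `A`.
  have hθξ : ∀ u, θ (π u) * ξ u = ξ u * ξ u := by
    intro u
    rw [Finset.sum_mul, Finset.sum_eq_single_of_mem u (by simp)]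
    intro w hw hwu
    exact h.mul_eq_zero_of_adj (hclique w u (by simpa using hw) hwu)
  let ι := {S : Finset U // Γ.IsIndepSet (S : Set U) ∧ ∀ x, b x ∉ S}
  let e : ι → R := fun S => ∏ u ∈ S.1, ξ u
  have hspan : ∀ r : R, r ∈ Submodule.span A (Set.range e) := by
    have hone : (1 : R) ∈ Submodule.span A (Set.range e) :=
      Submodule.subset_span ⟨⟨∅, by simp [SimpleGraph.IsIndepSet], by simp⟩, by simp [e]⟩
    have hθ : ∀ x, ∀ r ∈ Submodule.span A (Set.range e), θ x * r ∈
        Submodule.span A (Set.range e) := by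
      intro x r hr
      have := Submodule.smul_mem _ (X x : A) hr
      rwa [hsmul, aeval_X] at this
    have hnb : ∀ u, (∀ x, b x ≠ u) → ∀ r ∈ Submodule.span A (Set.range e), ξ u * r ∈
        Submodule.span A (Set.range e) := by
      intro u hu r hr
      induction hr using Submodule.span_induction with
      | mem r hr =>
        obtain ⟨S, rfl⟩ := hr
        by_cases huS : u ∈ S.1
        · have : ξ u * e S = θ (π u) * e S := by
            simp only [e]
            rw [← Finset.mul_prod_erase _ _ huS, ← mul_assoc, ← mul_assoc, hθξ]
          rw [this]
          exact hθ _ _ (Submodule.subset_span ⟨S, rfl⟩)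
        · have : ξ u * e S = ∏ w ∈ insert u S.1, ξ w := by rw [Finset.prod_insert huS]
          rw [this]
          by_cases hind : Γ.IsIndepSet (insert u S.1 : Finset U)
          · refine Submodule.subset_span ⟨⟨insert u S.1, hind, fun x hx => ?_⟩, rfl⟩
            rcases Finset.mem_insert.1 hx with hx | hx
            · exact hu x hx
            · exact S.2.2 x hx
          · rw [h.prod_eq_zero _ hind]
            exact zero_mem _
      | zero => simp
      | add r s _ _ hr hs => rw [mul_add]; exact add_mem hr hs
      | smul a r _ hr => rw [mul_smul_comm]; exact Submodule.smul_mem _ _ hr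
    intro r
    induction r using h.induction with
    | hC c =>
      have := Submodule.smul_mem _ (C c : A) hone
      rwa [hsmul, mul_one, aeval_C] at this
    | hadd r s hr hs => exact add_mem hr hs
    | hmul r u hr =>
      rw [mul_comm]
      by_cases hu : ∀ x, b x ≠ u
      · exact hnb u hu r hr
      · push Not at hu
        obtain ⟨x, rfl⟩ := hu
        -- The variable of `b x` is eliminated in favour of `θ x` and the other variables of its
        -- clique.
        have hx : θ x = ξ (b x) + ∑ u ∈ (Finset.univ.filter (π · = x)).erase (b x), ξ u :=
          (Finset.add_sum_erase _ ξ (by simp [hb])).symm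
        change ξ (b x) * r ∈ _
        rw [eq_sub_of_add_eq hx.symm, sub_mul]
        refine sub_mem (hθ x r hr) ?_
        rw [Finset.sum_mul]
        refine sum_mem fun u hu => hnb u (fun y hy => ?_) r hr
        simp only [Finset.mem_erase, Finset.mem_filter, Finset.mem_univ, true_and] at hu
        apply hu.1
        rw [← hy, ← hu.2, ← hy, hb]
  have hindep : LinearIndependent A e := by
    rw [Fintype.linearIndependent_iff]
    intro g hg S
    induction hn : S.1.card using Nat.strong_induction_on generalizing S with
    | _ n ih =>
    subst hn
    -- Complete `S` to a face with exactly one vertex in each clique, using `b x` where `S` misses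
    -- the clique. Evaluation on `F` sends `θ x` to `X x` and kills `e T` unless `T ⊆ S`; proper
    -- subsets are handled by induction on the cardinality.
    let F : Set U := {u | u ∈ S.1 ∨ u = b (π u) ∧ ∀ w ∈ S.1, π w ≠ π u}
    have hF : Γ.IsIndepSet F := by
      have hbF : ∀ u w, u ∈ F → w = b (π w) → (∀ v ∈ S.1, π v ≠ π w) → u ≠ w →
          ¬ Γ.Adj w u := by
        intro u w hu hw hS huw h
        rw [hw] at h
        have hπ := hfree _ _ h
        rcases hu with hu | ⟨hu, -⟩
        · exact hS u hu hπ
        · exact huw (by rw [hu, hw, hπ])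
      rintro u hu w hw huw
      rcases hw with hw | ⟨hw, hw'⟩
      · rcases hu with hu | ⟨hu, hu'⟩
        · exact S.2.1 hu hw huw
        · exact hbF w u (Or.inl hw) hu hu' huw.symm
      · exact fun h => hbF u w hu hw hw' huw h.symm
    obtain ⟨φ₀, hφ₁, hφ₀⟩ := h.exists_eval F hF
    let φ : R →ₐ[k] A := (rename π).comp φ₀
    have hφ1 : ∀ u ∈ F, φ (ξ u) = X (π u) := fun u hu => by simp [φ, hφ₁ u hu]
    have hφ0 : ∀ u ∉ F, φ (ξ u) = 0 := fun u hu => by simp [φ, hφ₀ u hu]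
    have hφθ : ∀ x, φ (θ x) = X x := by
      intro x
      obtain ⟨u, hu, hux⟩ : ∃ u ∈ F, π u = x := by
        by_cases hx : ∃ w ∈ S.1, π w = x
        · obtain ⟨w, hw, hwx⟩ := hx
          exact ⟨w, Or.inl hw, hwx⟩
        · push Not at hx
          exact ⟨b x, Or.inr ⟨by rw [hb], by simpa [hb] using hx⟩, hb x⟩
      rw [map_sum, Finset.sum_eq_single_of_mem u (by simpa using hux), hφ1 u hu, hux]
      intro w hw hwu
      refine hφ0 w fun hwF => ?_
      exact hF hwF hu hwu (hclique w u (by rw [hux]; simpa using hw) hwu)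
    have hφA : ∀ a : A, φ (aeval θ a) = a := by
      intro a
      have : φ.comp (aeval θ) = AlgHom.id k A :=
        MvPolynomial.algHom_ext fun x => by rw [AlgHom.comp_apply, aeval_X, hφθ]; rfl
      exact DFunLike.congr_fun this a
    have h0 := congrArg φ hg
    rw [map_zero, map_sum, Finset.sum_eq_single_of_mem S (Finset.mem_univ _)] at h0
    · rw [hsmul, map_mul, hφA, map_prod] at h0
      refine (mul_eq_zero.1 h0).resolve_right (Finset.prod_ne_zero_iff.2 fun u hu => ?_)
      rw [hφ1 u (Or.inl hu)]
      exact X_ne_zero _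
    · intro T _ hTS
      rw [hsmul, map_mul, hφA]
      by_cases hT : T.1 ⊆ S.1
      · rw [ih _ (Finset.card_lt_card (hT.ssubset_of_ne fun h => hTS (Subtype.ext h))) T rfl,
          zero_mul]
      · obtain ⟨u, huT, huS⟩ := Finset.not_subset.1 hT
        have : φ (e T) = 0 := by
          rw [map_prod]
          refine Finset.prod_eq_zero huT (hφ0 u ?_)
          rintro (h | ⟨h, -⟩)
          · exact huS h
          · exact T.2.2 (π u) (h ▸ huT)
        rw [this, mul_zero]
  let B : Module.Basis ι A R := .mk hindep fun r _ => hspan r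
  have : Module.Free A R := .of_basis B
  have : Module.Finite A R := .of_basis B
  exact isCohenMacaulayRing_of_free k V

/-! ### Purity: facets of a Cohen–Macaulay face ring -/

/-- In a Cohen–Macaulay face ring no face is larger than a facet. -/
theorem card_le_card [Finite U] (h : IsFaceRing k Γ ξ) (hR : IsCohenMacaulayRing R) {F E : Finset U}
    (hF : Γ.IsIndepSet (F : Set U)) (hmax : ∀ u ∉ F, ∃ w ∈ F, Γ.Adj u w)
    (hE : Γ.IsIndepSet (E : Set U)) : E.card ≤ F.card := by
  classical
  have : IsNoetherianRing R := hR.isNoetherianRing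
  obtain ⟨φ₀, -, hφ₀⟩ := h.exists_eval ∅ (by simp [SimpleGraph.IsIndepSet])
  -- Evaluation at the origin; its kernel `m` is the ideal generated by the variables.
  let ε : R →ₐ[k] k := (aeval (0 : U → k)).comp φ₀
  have hεξ : ∀ u, ε (ξ u) = 0 := fun u => by simp [ε, hφ₀ u]
  have hεs : Function.Surjective ε := fun c => ⟨algebraMap k R c, by simp⟩
  let m : Ideal R := RingHom.ker ε
  have hm : m.IsMaximal := RingHom.ker_isMaximal_of_surjective ε hεs
  have hspan : m = Ideal.span (Set.range ξ) := by
    apply le_antisymm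
    · have key : ∀ r : R, r - algebraMap k R (ε r) ∈ Ideal.span (Set.range ξ) := by
        intro r
        induction r using h.induction with
        | hC c => simp
        | hadd r s hr hs =>
          have := add_mem hr hs
          rw [map_add, map_add]
          convert this using 1
          ring
        | hmul r u hr =>
          rw [map_mul, hεξ, mul_zero, map_zero, sub_zero]
          exact Ideal.mul_mem_left _ _ (Ideal.subset_span ⟨u, rfl⟩)
      intro r hr
      have hr' : ε r = 0 := hr
      simpa [hr'] using key r
    · rw [Ideal.span_le]
      rintro _ ⟨u, rfl⟩
      exact hεξ u
  let L := Localization.AtPrime m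
  -- If `s` kills the monomial of `F`, evaluating on `F` in a domain forces `φ s = 0`, so `s`
  -- vanishes at the origin and lies in `m`.
  have hz : algebraMap R L (∏ u ∈ F, ξ u) ≠ 0 := by
    intro hz
    obtain ⟨⟨s, hs⟩, hsz⟩ := (IsLocalization.map_eq_zero_iff m.primeCompl L _).1 hz
    obtain ⟨φ, hφ1, hφ0⟩ := h.exists_eval F hF
    have h0 := congrArg φ hsz
    rw [map_mul, map_zero, map_prod] at h0
    have hs0 := (mul_eq_zero.1 h0).resolve_right <| Finset.prod_ne_zero_iff.2 fun u hu => by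
      rw [hφ1 u hu]; exact X_ne_zero _
    have hcomp : (aeval (0 : U → k)).comp φ = ε := h.algHom_ext fun u => by
      rw [hεξ, AlgHom.comp_apply]
      by_cases hu : u ∈ F
      · rw [hφ1 u hu]; simp
      · rw [hφ0 u hu, map_zero]
    apply hs
    change ε s = 0
    rw [← hcomp, AlgHom.comp_apply, hs0, map_zero]
  have hmaxL : maximalIdeal L = Ideal.span (Set.range fun u => algebraMap R L (ξ u)) := by
    rw [← IsLocalization.AtPrime.map_eq_maximalIdeal m]
    refine (congrArg (Ideal.map (algebraMap R L)) hspan).trans ?_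
    rw [Ideal.map_span, ← Set.range_comp]
    rfl
  have hupper : (localDepth L : WithBot ℕ∞) ≤ F.card := by
    refine localDepth_le_card hmaxL hz fun u hu => ?_
    obtain ⟨w, hw, huw⟩ := hmax u hu
    rw [← map_mul, ← Finset.mul_prod_erase _ _ hw, ← mul_assoc, h.mul_eq_zero_of_adj huw, zero_mul,
      map_zero]
  -- Projection onto the polynomial ring in the variables of `E` induces a surjection of local rings
  -- at the origins.
  have hlower : (E.card : WithBot ℕ∞) ≤ ringKrullDim L := by
    obtain ⟨ψ₀, hψ1, hψ0⟩ := h.exists_eval E hE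
    let ψ : R →ₐ[k] MvPolynomial E k :=
      (aeval fun u => if hu : u ∈ E then X ⟨u, hu⟩ else 0).comp ψ₀
    have hψs : Function.Surjective ψ := by
      rw [← AlgHom.range_eq_top, eq_top_iff, ← MvPolynomial.adjoin_range_X, Algebra.adjoin_le_iff]
      rintro _ ⟨u, rfl⟩
      exact ⟨ξ u, by simp [ψ, hψ1 u.1 u.2]⟩
    let δ : MvPolynomial E k →ₐ[k] k := aeval 0
    let n : Ideal (MvPolynomial E k) := RingHom.ker δ
    have hn : n.IsMaximal := RingHom.ker_isMaximal_of_surjective δ fun c => ⟨C c, by simp [δ]⟩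
    have hδψ : δ.comp ψ = ε := h.algHom_ext fun u => by
      rw [hεξ]
      by_cases hu : u ∈ E
      · simp [ψ, δ, hψ1 u hu, hu]
      · simp [ψ, hψ0 u hu]
    have hmn : m = n.comap ψ.toRingHom := by
      ext r
      change ε r = 0 ↔ δ (ψ r) = 0
      rw [← hδψ, AlgHom.comp_apply]
    have := ringKrullDim_le_of_surjective _
      ((RingHom.surjectiveOnStalks_of_surjective (f := ψ.toRingHom) hψs).localRingHom_surjective
        m n hmn)
    rw [ringKrullDim_localization_of_free k E n] at this
    simpa using this
  rw [(hR.localization m).depth_eq_dim] at hupper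
  exact_mod_cast hlower.trans hupper

end IsFaceRing

end CoronaCM

/-! ### Facets and cliques of the corona -/

namespace CoronaCM

theorem exists_facet {U : Type*} [Finite U] (Γ : SimpleGraph U) :
    ∃ F : Finset U, Γ.IsIndepSet (F : Set U) ∧ ∀ u ∉ F, ∃ w ∈ F, Γ.Adj u w := by
  classical
  obtain ⟨F, -, hF⟩ := (Set.toFinite {F : Finset U | Γ.IsIndepSet (F : Set U)}).exists_le_maximal
    (a := ∅) (by simp [SimpleGraph.IsIndepSet])
  refine ⟨F, hF.prop, fun u hu => ?_⟩
  by_contra! hcon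
  have hins : Γ.IsIndepSet (insert u F : Finset U) := by
    rw [Finset.coe_insert]
    refine Set.Pairwise.insert hF.prop fun w hw _ => ⟨hcon w hw, fun h => hcon w hw h.symm⟩
  exact hu (hF.le_of_ge hins (Finset.subset_insert u F) (Finset.mem_insert_self u F))

section Corona
variable {V : Type*} {W : V → Type*} (G : SimpleGraph V) (H : ∀ x, SimpleGraph (W x))

theorem isCohenMacaulayGraph_corona_of_eq_top [Finite V] [∀ x, Finite (W x)] [∀ x, Nonempty (W x)]
    (k : Type*) [Field k] (hH : ∀ x, H x = ⊤) : IsCohenMacaulayGraph k (corona G H) := by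
  refine (isFaceRing_stanleyReisnerRing k _).isCohenMacaulayRing_of_clique_partition
    (Sum.elim id Sigma.fst) (fun x => Sum.inr ⟨x, Classical.arbitrary _⟩) (fun _ => rfl) ?_ ?_
  · rintro (x | ⟨x, a⟩) (y | ⟨y, c⟩) h hne <;> obtain rfl : x = y := h
    · exact absurd rfl hne
    · exact .join _ _
    · exact .join' _ _
    · refine .fiber ?_
      rw [hH, SimpleGraph.top_adj]
      rintro rfl
      exact hne rfl
  · rintro x w (_ | _ | _ | _) <;> rfl

/-- If all independent sets of the corona are bounded by each of its facets, then each `H x` is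
complete. -/
theorem eq_top_of_card_le_card [Finite V] [∀ x, Finite (W x)] [∀ x, Nonempty (W x)]
    (h : ∀ F E : Finset (V ⊕ Σ x, W x), (corona G H).IsIndepSet (F : Set (V ⊕ Σ x, W x)) →
      (∀ u ∉ F, ∃ w ∈ F, (corona G H).Adj u w) →
      (corona G H).IsIndepSet (E : Set (V ⊕ Σ x, W x)) → E.card ≤ F.card) (x : V) :
    H x = ⊤ := by
  classical
  rw [SimpleGraph.eq_top_iff_forall_ne_adj]
  intro a c hac
  by_contra hadj
  have hM : ∀ y, ∃ M : Finset (W y), (H y).IsIndepSet (M : Set (W y)) ∧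
      ∀ u ∉ M, ∃ w ∈ M, (H y).Adj u w := fun y => exists_facet (H y)
  choose M hMi hMm using hM
  -- Nonemptiness of `M y` is what dominates the base vertex `y` when `y ≠ x`.
  have hMne : ∀ y, ∃ w, w ∈ M y := fun y => by
    by_contra! hcon
    obtain ⟨w, hw, -⟩ := hMm y (Classical.arbitrary _) (hcon _)
    exact hcon w hw
  let P : Set (V ⊕ Σ x, W x) := {u | ∃ y w, y ≠ x ∧ w ∈ M y ∧ u = Sum.inr ⟨y, w⟩}
  obtain ⟨F, hF⟩ : ∃ F : Finset (V ⊕ Σ x, W x), ∀ u, u ∈ F ↔ u ∈ P :=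
    ⟨(Set.toFinite P).toFinset, fun u => Set.Finite.mem_toFinset _⟩
  have hFi : (corona G H).IsIndepSet (F : Set (V ⊕ Σ x, W x)) := by
    intro u hu w hw huw hadj
    obtain ⟨y, b, -, hb, rfl⟩ := (hF u).1 hu
    obtain ⟨z, d, -, hd, rfl⟩ := (hF w).1 hw
    cases hadj with
    | fiber hbd => exact hMi y hb hd hbd.ne hbd
  have hxF : Sum.inl x ∉ F := by simp [hF, P]
  have hWF : ∀ b : W x, Sum.inr ⟨x, b⟩ ∉ F := by
    rintro b hb
    obtain ⟨y, d, hy, -, h⟩ := (hF _).1 hb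
    cases h
    exact hy rfl
  have hins : ∀ (v : V ⊕ Σ x, W x) (K : Finset (V ⊕ Σ x, W x)),
      (corona G H).IsIndepSet (K : Set (V ⊕ Σ x, W x)) → (∀ u ∈ K, ¬ (corona G H).Adj v u) →
      (corona G H).IsIndepSet (insert v K : Finset (V ⊕ Σ x, W x)) := by
    intro v K hK hv
    rw [Finset.coe_insert]
    exact Set.Pairwise.insert hK fun u hu _ => ⟨hv u hu, fun h => hv u hu h.symm⟩
  have hWi : ∀ b : W x, ∀ u ∈ F, ¬ (corona G H).Adj (Sum.inr ⟨x, b⟩) u := by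
    intro b u hu hadj
    obtain ⟨y, d, hy, -, rfl⟩ := (hF u).1 hu
    cases hadj
    exact hy rfl
  -- The facet `F ∪ {x}` against the independent set `F ∪ {a, c}`: the bound would read `|F| + 2 ≤
  -- |F| + 1`.
  have key := h (insert (Sum.inl x) F) (insert (Sum.inr ⟨x, a⟩) (insert (Sum.inr ⟨x, c⟩) F))
    (hins _ _ hFi ?_) ?_ (hins _ _ (hins _ _ hFi (hWi c)) ?_)
  · rw [Finset.card_insert_of_notMem hxF, Finset.card_insert_of_notMem,
      Finset.card_insert_of_notMem (hWF c)] at key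
    · omega
    · rw [Finset.mem_insert, not_or]
      exact ⟨fun h => hac (by simpa using h), hWF a⟩
  · intro u hu hadj
    obtain ⟨y, d, hy, -, rfl⟩ := (hF u).1 hu
    cases hadj
    exact hy rfl
  · rintro (y | ⟨y, b⟩) hu
    · by_cases hy : y = x
      · exact absurd (by simp [hy]) hu
      · obtain ⟨w, hw⟩ := hMne y
        exact ⟨Sum.inr ⟨y, w⟩, Finset.mem_insert_of_mem ((hF _).2 ⟨y, w, hy, hw, rfl⟩), .join y w⟩
    · by_cases hy : y = x
      · subst hy
        exact ⟨Sum.inl y, Finset.mem_insert_self _ _, .join' y b⟩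
      · have hb : b ∉ M y := fun hb =>
          hu (Finset.mem_insert_of_mem ((hF _).2 ⟨y, b, hy, hb, rfl⟩))
        obtain ⟨w, hw, hbw⟩ := hMm y b hb
        exact ⟨Sum.inr ⟨y, w⟩, Finset.mem_insert_of_mem ((hF _).2 ⟨y, w, hy, hw, rfl⟩), .fiber hbw⟩
  · intro u hu
    rcases Finset.mem_insert.1 hu with rfl | hu
    · intro h
      cases h with
      | fiber h => exact hadj h
    · exact hWi a u hu
end Corona
end CoronaCM

theorem corollary2p7 {V : Type*} [Finite V] [Nonempty V] {W : V → Type*}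
    [∀ x, Finite (W x)] [∀ x, Nonempty (W x)]
    (G : SimpleGraph V) (H : ∀ x, SimpleGraph (W x)) (k : Type*) [Field k] :
    CoronaCM.IsCohenMacaulayGraph k (CoronaCM.corona G H) ↔ ∀ x, H x = ⊤ :=
  ⟨fun h => CoronaCM.eq_top_of_card_le_card G H fun _ _ hF hmax hE =>
    (CoronaCM.isFaceRing_stanleyReisnerRing k _).card_le_card h hF hmax hE,
    CoronaCM.isCohenMacaulayGraph_corona_of_eq_top G H k⟩
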